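/- A continuum is a connected compact metrizable space with more than one point. Let $Y$ be a continuum, let $x\in Y$, and let $X$ be the meager composant of $x$ in $Y$, that is, the union of all nowhere dense compact connected subsets of $Y$ containing $x$ (one-point sets are allowed). Give $X$ the subspace topology. Suppose that $X$ is indecomposable, i.e. the connected space $X$ is not the union of two proper closed connected subsets of $X$. Then: (i) every proper closed connected subset of $X$ is compact; (ii) $X$ is compact or $X$ is of first category (meager) in itself, i.e. $X$ is a union of countably many nowhere dense subsets of the space $X$; (iii) for every closed subset $A$ of $X$, the set $\{\mathrm{cnt}(a,A) : a\in A\}$ of connected components of $A$, where $\mathrm{cnt}(a,A)$ is the connected component of $a$ in the subspace $A$, endowed with the quotient topology from $A$, is metrizable and zero-dimensional, where a space is called zero-dimensional if it has a basis of clopen sets. -/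

import Mathlib

open Set TopologicalSpace

/-- The meager composant of `x` in `Y`: the union of all nowhere dense subcontinua of `Y`
containing `x`. One-point subcontinua are allowed here. -/
def meagerComposant {Y : Type*} [TopologicalSpace Y] (x : Y) : Set Y :=
  ⋃₀ {K : Set Y | IsCompact K ∧ IsConnected K ∧ IsNowhereDense K ∧ x ∈ K}

/-- `X` is a meager composant of `Y` if it is the meager composant of some point of `Y`. -/
def IsMeagerComposant {Y : Type*} [TopologicalSpace Y] (X : Set Y) : Prop :=
  ∃ x : Y, X = meagerComposant x

/-- A connected space is indecomposable if it is not the union of two proper closed connected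
subsets. (Whether the empty set counts as connected makes no difference here.) -/
def IsIndecomposableSpace (X : Type*) [TopologicalSpace X] : Prop :=
  ConnectedSpace X ∧
    ¬ ∃ H K : Set X, IsClosed H ∧ IsPreconnected H ∧ H ≠ univ ∧
      IsClosed K ∧ IsPreconnected K ∧ K ≠ univ ∧ H ∪ K = univ

/-- A space is zero-dimensional if its clopen subsets form a basis of the topology. -/
def IsZeroDimensional (Z : Type*) [TopologicalSpace Z] : Prop :=
  IsTopologicalBasis {s : Set Z | IsClopen s}

open Filter Topology Metric

/-! In an indecomposable connected space, proper closed connected sets have empty interior. The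
closure in `Y` of a nonempty such subset of `X` is thus a nowhere dense continuum meeting `X`, so it
lies in `X`; this gives (i). If `X` is not compact, countably many such sets cover it (components,
through the base point, of complements of basic open sets), which gives (ii) and σ-compactness.

For (iii) the heart is that the components of a proper closed `A` form an upper semicontinuous
decomposition (`IsThin.eventually_component_subset`). Suppose components of points tending to `a`
escape an open set around the component of `a`. They accumulate on a continuum `M ⊆ closure A`
through `a`. If `M` is nowhere dense, it lies in `A`, hence in the component of `a`, a
contradiction. Otherwise some escaping component meets the interior of `M`, and `M` bridges it to
the component of `a`. By boundary bumping, a bridge can be replaced by two bridges hugging its ends,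
joined by a connected subset of `A`, which is nowhere dense. Iterating, with the `n`-th step
uncovering part of the `n`-th basic open set, produces chains whose limit is a nowhere dense
continuum in `closure A`. It lies in `A` and joins the two components, a contradiction.

The component space is then normal and second countable, hence metrizable; being σ-compact and
totally disconnected, it has a clopen basis by a countable sum argument. -/

/-! ### Limits of sets along an ultrafilter -/

/-- The limit of a family of sets along an ultrafilter: the points all of whose neighborhoods
meet almost all sets of the family. -/
def ultraLim {ι Y : Type*} [TopologicalSpace Y] (F : Ultrafilter ι) (N : ι → Set Y) : Set Y :=
  {y | ∀ O ∈ 𝓝 y, ∀ᶠ i in F, (N i ∩ O).Nonempty}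

section UltraLim

variable {ι Y : Type*} [TopologicalSpace Y] {F : Ultrafilter ι} {N N' : ι → Set Y}

theorem ultraLim_mono (h : ∀ᶠ i in F, N i ⊆ N' i) : ultraLim F N ⊆ ultraLim F N' := by
  intro y hy O hO
  filter_upwards [h, hy O hO] with i hi h2 using h2.mono (inter_subset_inter_left _ hi)

theorem ultraLim_subset_of_isClosed {E : Set Y} (hE : IsClosed E) (h : ∀ᶠ i in F, N i ⊆ E) :
    ultraLim F N ⊆ E := by
  intro y hy
  by_contra hyE
  obtain ⟨i, hi, x, hx, hx'⟩ := (h.and (hy Eᶜ (hE.isOpen_compl.mem_nhds hyE))).exists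
  exact hx' (hi hx)

theorem isClosed_ultraLim : IsClosed (ultraLim F N) := by
  rw [← isOpen_compl_iff, isOpen_iff_mem_nhds]
  intro y hy
  simp only [ultraLim, mem_compl_iff, mem_ofPred_eq, not_forall] at hy
  obtain ⟨O, hO, h⟩ := hy
  obtain ⟨V, hVO, hV, hyV⟩ := mem_nhds_iff.1 hO
  refine mem_of_superset (hV.mem_nhds hyV) fun z hz hz' => h ?_
  filter_upwards [hz' V (hV.mem_nhds hz)] with i hi using hi.mono (inter_subset_inter_right _ hVO)

theorem mem_ultraLim_of_tendsto {c : ι → Y} {y : Y} (hc : ∀ᶠ i in F, c i ∈ N i)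
    (h : Tendsto c F (𝓝 y)) : y ∈ ultraLim F N := by
  intro O hO
  filter_upwards [hc, h hO] with i hi hi' using ⟨c i, hi, hi'⟩

/-- Points chosen in `N i ∩ E` converge along the ultrafilter, by compactness. -/
theorem inter_ultraLim_nonempty [CompactSpace Y] {E : Set Y} (hE : IsClosed E)
    (h : ∀ᶠ i in F, (N i ∩ E).Nonempty) : (ultraLim F N ∩ E).Nonempty := by
  classical
  obtain ⟨i₀, x₀, _, hx₀⟩ := h.exists
  -- The default `x₀` lies in `E`, so every `c i` does; only almost all need lie in `N i`.
  let c : ι → Y := fun i => if h : (N i ∩ E).Nonempty then h.some else x₀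
  have hcE : ∀ i, c i ∈ E := fun i => by
    by_cases hi : (N i ∩ E).Nonempty
    · simpa [c, hi] using hi.some_mem.2
    · simpa [c, hi] using hx₀
  have hcN : ∀ᶠ i in F, c i ∈ N i := h.mono fun i hi => by
    simpa [c, hi] using hi.some_mem.1
  obtain ⟨y, -, hy⟩ := isCompact_univ.ultrafilter_le_nhds (F.map c) (by simp)
  exact ⟨y, mem_ultraLim_of_tendsto hcN hy,
    hE.mem_of_tendsto (f := c) (b := (F : Filter ι)) hy (Eventually.of_forall hcE)⟩

theorem eventually_subset_of_ultraLim_subset [CompactSpace Y] {V : Set Y} (hV : IsOpen V)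
    (h : ultraLim F N ⊆ V) : ∀ᶠ i in F, N i ⊆ V := by
  by_contra hcon
  rw [← Ultrafilter.eventually_not] at hcon
  obtain ⟨y, hy, hy'⟩ := inter_ultraLim_nonempty (F := F) (N := N) hV.isClosed_compl
    (hcon.mono fun i hi => by
      obtain ⟨x, hx, hx'⟩ := not_subset.1 hi
      exact ⟨x, hx, hx'⟩)
  exact hy' (h hy)

/-- Disjoint open neighborhoods of the two halves of a separated limit would separate almost every
`N i`. -/
theorem isConnected_ultraLim [CompactSpace Y] [T2Space Y] (h : ∀ᶠ i in F, IsConnected (N i)) :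
    IsConnected (ultraLim F N) := by
  constructor
  · obtain ⟨y, hy, -⟩ := inter_ultraLim_nonempty (F := F) (N := N) isClosed_univ
      (h.mono fun i hi => by simpa using hi.nonempty)
    exact ⟨y, hy⟩
  · rw [isPreconnected_closed_iff]
    intro s t hs ht hst hns hnt
    by_contra hcon
    have hd : Disjoint (ultraLim F N ∩ s) (ultraLim F N ∩ t) := by
      rw [Set.disjoint_left]
      exact fun x hx hx' => hcon ⟨x, hx.1, hx.2, hx'.2⟩
    obtain ⟨u, v, hu, hv, hsu, htv, huv⟩ :=
      normal_separation (isClosed_ultraLim.inter hs) (isClosed_ultraLim.inter ht) hd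
    have hsub : ultraLim F N ⊆ u ∪ v := fun x hx =>
      (hst hx).imp (fun h => hsu ⟨hx, h⟩) fun h => htv ⟨hx, h⟩
    obtain ⟨p, hp⟩ := hns
    obtain ⟨q, hq⟩ := hnt
    obtain ⟨i, hi, h1, h2, h3⟩ := (h.and ((eventually_subset_of_ultraLim_subset (hu.union hv)
      hsub).and ((hp.1 u (hu.mem_nhds (hsu hp))).and (hq.1 v (hv.mem_nhds (htv hq)))))).exists
    obtain ⟨z, -, hz⟩ := hi.isPreconnected u v hu hv h1 h2 h3
    exact huv.le_bot hz

end UltraLim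

theorem exists_tendsto_of_mem_ultraLim {ι Y : Type*} [MetricSpace Y] {F : Ultrafilter ι}
    {N : ι → Set Y} (hN : ∀ i, IsCompact (N i)) (hne : ∀ i, (N i).Nonempty) {y : Y}
    (hy : y ∈ ultraLim F N) : ∃ c : ι → Y, (∀ i, c i ∈ N i) ∧ Tendsto c F (𝓝 y) := by
  choose c hc hd using fun i => (hN i).exists_infDist_eq_dist (hne i) y
  refine ⟨c, hc, ?_⟩
  rw [Metric.tendsto_nhds]
  intro ε hε
  filter_upwards [hy (ball y ε) (ball_mem_nhds y hε)] with i hi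
  obtain ⟨x, hx, hx'⟩ := hi
  rw [dist_comm, ← hd i]
  exact (infDist_le_dist_of_mem hx).trans_lt (by rwa [dist_comm])

/-! ### Boundary bumping -/

/-- Boundary bumping: if the component of `N ∩ E` at `c` stays in an open set `V ⊆ E`, then
the continuum `N` is contained in `V`. -/
theorem subset_of_connectedComponentIn_subset {Y : Type*} [TopologicalSpace Y] [T2Space Y]
    {N E V : Set Y} (hNc : IsCompact N) (hN : IsPreconnected N) (hE : IsClosed E)
    (hV : IsOpen V) (hVE : V ⊆ E) {c : Y} (hc : c ∈ N ∩ E)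
    (h : connectedComponentIn (N ∩ E) c ⊆ V) : N ⊆ V := by
  have hK : IsCompact (N ∩ E) := hNc.inter_right hE
  have : Nonempty { s : Set ↥(N ∩ E) // IsClopen s ∧ (⟨c, hc⟩ : ↥(N ∩ E)) ∈ s } :=
    ⟨⟨univ, isClopen_univ, mem_univ _⟩⟩
  have : CompactSpace ↥(N ∩ E) := isCompact_iff_compactSpace.1 hK
  rw [connectedComponentIn_eq_image hc, image_subset_iff,
    connectedComponent_eq_iInter_isClopen] at h
  obtain ⟨⟨Z, hZc, hcZ⟩, hZV⟩ := exists_subset_nhds_of_isCompact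
    (V := fun s : { s : Set ↥(N ∩ E) // IsClopen s ∧ (⟨c, hc⟩ : ↥(N ∩ E)) ∈ s } => s.1)
    (by
      rintro ⟨s, hs, hcs⟩ ⟨t, ht, hct⟩
      exact ⟨⟨s ∩ t, hs.inter ht, hcs, hct⟩, inter_subset_left, inter_subset_right⟩)
    (fun s => s.2.1.1.isCompact)
    (U := Subtype.val ⁻¹' V)
    (fun x hx => (hV.preimage continuous_subtype_val).mem_nhds (h hx))
  simp only at hZV
  have h1 : IsClosed (Subtype.val '' Z : Set Y) :=
    (hZc.1.isCompact.image continuous_subtype_val).isClosed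
  have h2 : IsClosed (Subtype.val '' Zᶜ : Set Y) :=
    (hZc.compl.1.isCompact.image continuous_subtype_val).isClosed
  -- In the compact set `N ∩ E` components are quasi-components, so a relatively clopen `Z` fits
  -- between the component and `V`. As `Z` avoids `Vᶜ`, it would split off from the rest of `N`.
  have hcov : N ⊆ (Subtype.val '' Z : Set Y) ∪ (Subtype.val '' Zᶜ ∪ Vᶜ) := by
    intro x hx
    by_cases hxV : x ∈ V
    · by_cases hxZ : (⟨x, hx, hVE hxV⟩ : ↥(N ∩ E)) ∈ Z
      · exact Or.inl ⟨_, hxZ, rfl⟩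
      · exact Or.inr (Or.inl ⟨_, hxZ, rfl⟩)
    · exact Or.inr (Or.inr hxV)
  intro x hx
  by_contra hxV
  obtain ⟨y, -, ⟨z, hz, rfl⟩, hy⟩ := isPreconnected_closed_iff.1 hN _ _ h1
    (h2.union hV.isClosed_compl) hcov ⟨c, hc.1, _, hcZ, rfl⟩ ⟨x, hx, Or.inr hxV⟩
  rcases hy with ⟨w, hw, hwz⟩ | hy
  · exact hw (Subtype.ext hwz ▸ hz)
  · exact hy (hZV hz)

/-! ### Sets whose connected subsets are thin -/

/-- `A` contains only nowhere dense connected sets, and every nowhere dense continuum in its closure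
that meets `A` lies in `A`. -/
structure IsThin {Y : Type*} [TopologicalSpace Y] (A : Set Y) : Prop where
  isNowhereDense : ∀ S ⊆ A, IsPreconnected S → IsNowhereDense S
  subset : ∀ P, IsCompact P → IsConnected P → IsNowhereDense P → P ⊆ closure A →
    (P ∩ A).Nonempty → P ⊆ A

/-- `M` is a limit of continua contained in `A`. -/
def IsLimOfContinua {ι Y : Type*} [TopologicalSpace Y] (F : Ultrafilter ι) (A M : Set Y) : Prop :=
  ∃ K : ι → Set Y, (∀ i, IsConnected (K i) ∧ IsCompact (K i) ∧ K i ⊆ A) ∧ M = ultraLim F K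

/-- `M` meets `N`, which is a component of `A ∩ E` for some closed `E` containing `M`. -/
def Touches {Y : Type*} [TopologicalSpace Y] (A M N : Set Y) : Prop :=
  (M ∩ N).Nonempty ∧ ∃ E, IsClosed E ∧ M ⊆ E ∧ ∃ a ∈ A ∩ E, N = connectedComponentIn (A ∩ E) a

/-- `Link F A N N' S P` says that `P` is a chain from `N` to `N'` made of components of relatively
closed subsets of `A`, with union `S`, consecutive ones being bridged by limits of continua
contained in `A`. -/
inductive Link {ι Y : Type*} [TopologicalSpace Y] (F : Ultrafilter ι) (A : Set Y) :
    Set Y → Set Y → Set Y → Set Y → Prop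
  | bridge {N N' M : Set Y} : IsLimOfContinua F A M → Touches A M N → Touches A M N' →
      Link F A N N' (N ∪ N') (N ∪ M ∪ N')
  | trans {N N' N'' S S' P P' : Set Y} : Link F A N N' S P → Link F A N' N'' S' P' →
      Link F A N N'' (S ∪ S') (P ∪ P')

theorem isNowhereDense_union {Y : Type*} [TopologicalSpace Y] {s t : Set Y}
    (hs : IsNowhereDense s) (ht : IsNowhereDense t) : IsNowhereDense (s ∪ t) := by
  unfold IsNowhereDense at *
  rw [closure_union, interior_union_isClosed_of_interior_empty isClosed_closure ht, hs]

theorem exists_cthickening_not_superset {Y : Type*} [MetricSpace Y] {S O : Set Y}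
    (hS : IsClosed S) (h : ¬ O ⊆ S) : ∃ δ > 0, ∀ ε ≤ δ, ¬ O ⊆ cthickening ε S := by
  obtain ⟨x, hx, hxS⟩ := not_subset.1 h
  rw [← hS.closure_eq, closure_eq_iInter_cthickening] at hxS
  simp only [mem_iInter, not_forall] at hxS
  obtain ⟨δ, hδ, hxδ⟩ := hxS
  exact ⟨δ, hδ, fun ε hε hsub => hxδ (cthickening_mono hε S (hsub hx))⟩

/-! ### Elementary properties of bridges and chains -/

section

variable {ι Y : Type*} [TopologicalSpace Y] {F : Ultrafilter ι} {A : Set Y}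

theorem IsLimOfContinua.isClosed {M : Set Y} (h : IsLimOfContinua F A M) : IsClosed M := by
  obtain ⟨K, hK, rfl⟩ := h
  exact isClosed_ultraLim

theorem IsLimOfContinua.subset_closure {M : Set Y} (h : IsLimOfContinua F A M) :
    M ⊆ closure A := by
  obtain ⟨K, hK, rfl⟩ := h
  exact ultraLim_subset_of_isClosed isClosed_closure
    (Eventually.of_forall fun i => (hK i).2.2.trans _root_.subset_closure)

theorem Touches.subset {M N : Set Y} (h : Touches A M N) : N ⊆ A := by
  obtain ⟨-, E, -, -, a, -, rfl⟩ := h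
  exact (connectedComponentIn_subset _ _).trans inter_subset_left

theorem Touches.isConnected {M N : Set Y} (h : Touches A M N) : IsConnected N := by
  obtain ⟨-, E, -, -, a, ha, rfl⟩ := h
  exact isConnected_connectedComponentIn_iff.2 ha

theorem Link.left_subset {N N' S P : Set Y} (h : Link F A N N' S P) : N ⊆ S := by
  induction h with
  | bridge => exact subset_union_left
  | trans _ _ ih _ => exact ih.trans subset_union_left

theorem Link.right_subset {N N' S P : Set Y} (h : Link F A N N' S P) : N' ⊆ S := by
  induction h with
  | bridge => exact subset_union_right
  | trans _ _ _ ih => exact ih.trans subset_union_right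

theorem Link.subset {N N' S P : Set Y} (h : Link F A N N' S P) : S ⊆ P := by
  induction h with
  | bridge => exact union_subset_union_left _ subset_union_left
  | trans _ _ ih ih' => exact union_subset_union ih ih'

theorem Link.right_nonempty {N N' S P : Set Y} (h : Link F A N N' S P) : N'.Nonempty := by
  induction h with
  | bridge _ _ h => exact h.isConnected.nonempty
  | trans _ _ _ ih => exact ih

theorem Link.subset_closure {N N' S P : Set Y} (h : Link F A N N' S P) : P ⊆ closure A := by
  induction h with
  | bridge hM h h' =>
    exact union_subset (union_subset (h.subset.trans _root_.subset_closure) hM.subset_closure)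
      (h'.subset.trans _root_.subset_closure)
  | trans _ _ ih ih' => exact union_subset ih ih'

/-- Only the nodes are counted in `S`; the bridges, which may have interior, enter `P` alone. -/
theorem Link.isNowhereDense (hA : IsThin A) {N N' S P : Set Y} (h : Link F A N N' S P) :
    IsNowhereDense S := by
  induction h with
  | bridge _ h h' =>
    exact isNowhereDense_union (hA.isNowhereDense _ h.subset h.isConnected.isPreconnected)
      (hA.isNowhereDense _ h'.subset h'.isConnected.isPreconnected)
  | trans _ _ ih ih' => exact isNowhereDense_union ih ih'

end

/-! ### Shrinking and splitting bridges -/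

section Thin

variable {ι Y : Type*} [MetricSpace Y] [CompactSpace Y] {F : Ultrafilter ι} {A : Set Y}

theorem IsThin.closure_subset (hA : IsThin A) {S : Set Y} (hSA : S ⊆ A) (hS : IsPreconnected S) :
    closure S ⊆ A := by
  rcases S.eq_empty_or_nonempty with rfl | hne
  · simp
  · exact hA.subset _ isClosed_closure.isCompact ⟨hne.closure, hS.closure⟩
      (hA.isNowhereDense S hSA hS).closure (closure_mono hSA)
      (hne.mono (subset_inter subset_closure hSA))

/-- Thinness keeps the closure of a connected subset inside `A`, so components are closed in `Y`
even though `A` need not be. -/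
theorem IsThin.isClosed_component (hA : IsThin A) {E : Set Y} (hE : IsClosed E) (a : Y) :
    IsClosed (connectedComponentIn (A ∩ E) a) := by
  by_cases ha : a ∈ A ∩ E
  · have hsub := connectedComponentIn_subset (A ∩ E) a
    have hpre := isPreconnected_connectedComponentIn (x := a) (F := A ∩ E)
    refine isClosed_of_closure_subset (hpre.closure.subset_connectedComponentIn
      (subset_closure (mem_connectedComponentIn ha)) (subset_inter ?_ ?_))
    · exact hA.closure_subset (hsub.trans inter_subset_left) hpre
    · exact closure_minimal (hsub.trans inter_subset_right) hE
  · simp [connectedComponentIn_eq_empty ha]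

theorem IsLimOfContinua.isConnected {M : Set Y} (h : IsLimOfContinua F A M) : IsConnected M := by
  obtain ⟨K, hK, rfl⟩ := h
  exact isConnected_ultraLim (Eventually.of_forall fun i => (hK i).1)

theorem Touches.isClosed {M N : Set Y} (hA : IsThin A) (h : Touches A M N) : IsClosed N := by
  obtain ⟨-, E, hE, -, a, ha, rfl⟩ := h
  exact hA.isClosed_component hE a

/-- A nowhere dense continuum inside `M` that meets `N` is absorbed by `N`. -/
theorem Touches.absorb (hA : IsThin A) {M N M' : Set Y} (h : Touches A M N)
    (hM : M' ⊆ closure A) (hMM : M' ⊆ M) (hc : IsClosed M') (hM' : IsConnected M')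
    (hnd : IsNowhereDense M') (hne : (M' ∩ N).Nonempty) : M' ⊆ N := by
  have hNA := h.subset
  obtain ⟨-, E, hE, hME, a, ha, rfl⟩ := h
  have h1 : M' ⊆ A := hA.subset M' hc.isCompact hM' hnd hM
    (hne.mono (inter_subset_inter_right _ hNA))
  obtain ⟨y, hy, hy'⟩ := hne
  rw [connectedComponentIn_eq hy']
  -- This is the purpose of `E` in `Touches`: it contains `M`, so `M'` stays in the set of which `N`
  -- is a component.
  exact hM'.isPreconnected.subset_connectedComponentIn hy (subset_inter h1 (hMM.trans hME))

/-- A limit `M` with interior that touches `N` contains such a limit arbitrarily close to `N`. -/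
theorem Touches.exists_near (hA : IsThin A) {M N : Set Y} (hM : IsLimOfContinua F A M)
    (h : Touches A M N) (hint : (interior M).Nonempty) {δ : ℝ} (hδ : 0 < δ) :
    ∃ M', IsLimOfContinua F A M' ∧ Touches A M' N ∧ (interior M').Nonempty ∧ M' ⊆ M ∧
      M' ⊆ cthickening δ N := by
  classical
  by_cases hsub : M ⊆ cthickening δ N
  · exact ⟨M, hM, h, hint, Subset.rfl, hsub⟩
  have hMcl := hM.subset_closure
  obtain ⟨K, hK, rfl⟩ := hM
  obtain ⟨c, hcM, hcN⟩ := h.1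
  obtain ⟨k, hk, hkc⟩ := exists_tendsto_of_mem_ultraLim (fun i => (hK i).2.1)
    (fun i => (hK i).1.nonempty) hcM
  have hkV : ∀ᶠ i in F, k i ∈ thickening δ N :=
    hkc (isOpen_thickening.mem_nhds (self_subset_thickening hδ N hcN))
  -- The fallback `K i` concerns only a negligible set of indices; it keeps every `K' i` a continuum
  -- in `A`.
  let K' : ι → Set Y := fun i => if k i ∈ cthickening δ N then
    connectedComponentIn (K i ∩ cthickening δ N) (k i) else K i
  have hpos : ∀ {i}, k i ∈ cthickening δ N →
      K' i = connectedComponentIn (K i ∩ cthickening δ N) (k i) := fun hi => if_pos hi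
  have hneg : ∀ {i}, k i ∉ cthickening δ N → K' i = K i := fun hi => if_neg hi
  have hK'K : ∀ i, K' i ⊆ K i := fun i => by
    by_cases hi : k i ∈ cthickening δ N
    · rw [hpos hi]
      exact (connectedComponentIn_subset _ _).trans inter_subset_left
    · rw [hneg hi]
  have hK' : ∀ i, IsConnected (K' i) ∧ IsCompact (K' i) ∧ K' i ⊆ A := fun i => by
    refine ⟨?_, ?_, (hK'K i).trans (hK i).2.2⟩
    · by_cases hi : k i ∈ cthickening δ N
      · rw [hpos hi]
        exact isConnected_connectedComponentIn_iff.2 ⟨hk i, hi⟩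
      · rw [hneg hi]
        exact (hK i).1
    · by_cases hi : k i ∈ cthickening δ N
      · have hcomp : IsClosed (K i ∩ cthickening δ N) :=
          (hK i).2.1.isClosed.inter isClosed_cthickening
        have hmem : k i ∈ K i ∩ cthickening δ N := ⟨hk i, hi⟩
        rw [hpos hi]
        refine (isClosed_of_closure_subset ?_).isCompact
        exact isPreconnected_connectedComponentIn.closure.subset_connectedComponentIn
          (_root_.subset_closure (mem_connectedComponentIn hmem))
          (closure_minimal (connectedComponentIn_subset _ _) hcomp)
      · rw [hneg hi]
        exact (hK i).2.1
  have hkK' : ∀ i, k i ∈ K' i := fun i => by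
    by_cases hi : k i ∈ cthickening δ N
    · rw [hpos hi]
      exact mem_connectedComponentIn ⟨hk i, hi⟩
    · rw [hneg hi]
      exact hk i
  have hlim : IsLimOfContinua F A (ultraLim F K') := ⟨K', hK', rfl⟩
  have hsubM : ultraLim F K' ⊆ ultraLim F K := ultraLim_mono (Eventually.of_forall hK'K)
  have hc' : c ∈ ultraLim F K' := mem_ultraLim_of_tendsto (Eventually.of_forall hkK') hkc
  have htouch : Touches A (ultraLim F K') N := by
    obtain ⟨-, E, hE, hME, hE'⟩ := h
    exact ⟨⟨c, hc', hcN⟩, E, hE, hsubM.trans hME, hE'⟩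
  have hcth : ultraLim F K' ⊆ cthickening δ N := by
    refine ultraLim_subset_of_isClosed isClosed_cthickening ?_
    filter_upwards [hkV] with i hi
    rw [hpos (thickening_subset_cthickening δ N hi)]
    exact (connectedComponentIn_subset _ _).trans inter_subset_right
  refine ⟨_, hlim, htouch, ?_, hsubM, hcth⟩
  -- If the shrunken limit were nowhere dense, `N` would absorb it. Almost all `K' i` would then
  -- stay in the open thickening, and boundary bumping would confine the whole `K i` there, against
  -- `hsub`.
  by_contra hemp
  rw [not_nonempty_iff_eq_empty, ← hlim.isClosed.isNowhereDense_iff] at hemp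
  have habs := h.absorb hA (hsubM.trans hMcl) hsubM hlim.isClosed hlim.isConnected hemp ⟨c, hc', hcN⟩
  apply hsub
  refine ultraLim_subset_of_isClosed isClosed_cthickening ?_
  have hev := eventually_subset_of_ultraLim_subset isOpen_thickening
    (habs.trans (self_subset_thickening hδ N))
  filter_upwards [hev, hkV] with i hi hki
  have hki' := thickening_subset_cthickening δ N hki
  rw [hpos hki'] at hi
  exact (subset_of_connectedComponentIn_subset (hK i).2.1 (hK i).1.isPreconnected
    isClosed_cthickening isOpen_thickening (thickening_subset_cthickening δ N) ⟨hk i, hki'⟩ hi).trans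
    (thickening_subset_cthickening δ N)

/-- A bridge can be replaced by two bridges close to its ends and a continuum in between. -/
theorem exists_refined_bridge (hA : IsThin A) {M N N' : Set Y} (hM : IsLimOfContinua F A M)
    (h : Touches A M N) (h' : Touches A M N') {δ : ℝ} (hδ : 0 < δ) :
    ∃ N₁ M₁ M₂, IsLimOfContinua F A M₁ ∧ IsLimOfContinua F A M₂ ∧ Touches A M₁ N ∧
      Touches A M₁ N₁ ∧ Touches A M₂ N₁ ∧ Touches A M₂ N' ∧ N₁ ⊆ cthickening δ M ∧
      M₁ ⊆ M ∧ M₂ ⊆ M ∧ M₁ ⊆ cthickening δ N ∧ M₂ ⊆ cthickening δ N' := by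
  by_cases hint : (interior M).Nonempty
  · obtain ⟨M₁, hl₁, ht₁, hi₁, hM₁, hc₁⟩ := h.exists_near hA hM hint hδ
    obtain ⟨M₂, hl₂, ht₂, hi₂, hM₂, hc₂⟩ := h'.exists_near hA hM hint hδ
    obtain ⟨K, hK, rfl⟩ := hM
    -- Interior is what makes a single `K i` meet both shrunken bridges. The component containing it
    -- is taken in `A ∩ cthickening δ M`, so that the new node stays near the old bridge.
    have hmeet : ∀ M' ⊆ ultraLim F K, (interior M').Nonempty →
        ∀ᶠ i in F, (K i ∩ M').Nonempty := by
      rintro M' hM' ⟨y, hy⟩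
      filter_upwards [hM' (interior_subset hy) _ (isOpen_interior.mem_nhds hy)] with i hi
        using hi.mono (inter_subset_inter_right _ interior_subset)
    obtain ⟨i, ⟨x, hx, hx₁⟩, ⟨y, hy, hy₂⟩, hi⟩ := ((hmeet M₁ hM₁ hi₁).and
      ((hmeet M₂ hM₂ hi₂).and (eventually_subset_of_ultraLim_subset isOpen_thickening
        (self_subset_thickening hδ (ultraLim F K))))).exists
    have hKi : K i ⊆ A ∩ cthickening δ (ultraLim F K) :=
      subset_inter (hK i).2.2 (hi.trans (thickening_subset_cthickening _ _))
    have hsub := (hK i).1.isPreconnected.subset_connectedComponentIn hx hKi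
    refine ⟨connectedComponentIn (A ∩ cthickening δ (ultraLim F K)) x, M₁, M₂, hl₁, hl₂, ht₁,
      ⟨⟨x, hx₁, hsub hx⟩, _, isClosed_cthickening, hM₁.trans (self_subset_cthickening _), x,
        hKi hx, rfl⟩,
      ⟨⟨y, hy₂, hsub hy⟩, _, isClosed_cthickening, hM₂.trans (self_subset_cthickening _), x,
        hKi hx, rfl⟩, ht₂,
      (connectedComponentIn_subset _ _).trans inter_subset_right, hM₁, hM₂, hc₁, hc₂⟩
  · rw [not_nonempty_iff_eq_empty, ← hM.isClosed.isNowhereDense_iff] at hint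
    have hMN := h.absorb hA hM.subset_closure Subset.rfl hM.isClosed hM.isConnected hint h.1
    have hMN' := h'.absorb hA hM.subset_closure Subset.rfl hM.isClosed hM.isConnected hint h'.1
    obtain ⟨y, hy⟩ := hM.isConnected.nonempty
    -- A nowhere dense bridge lies in both ends and can itself serve as the middle node, with `E =
    -- M`.
    have hMA : A ∩ M = M := inter_eq_right.2 (hMN.trans h.subset)
    have hMM : Touches A M M :=
      ⟨⟨y, hy, hy⟩, M, hM.isClosed, Subset.rfl, y, by rwa [hMA], by
        rw [hMA, hM.isConnected.isPreconnected.connectedComponentIn hy]⟩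
    exact ⟨M, M, M, hM, hM, h, hMM, hMM, h', self_subset_cthickening _, Subset.rfl, Subset.rfl,
      hMN.trans (self_subset_cthickening _), hMN'.trans (self_subset_cthickening _)⟩

/-! ### Refining chains and passing to the limit -/

theorem Link.isConnected {N N' S P : Set Y} (h : Link F A N N' S P) : IsConnected P := by
  induction h with
  | bridge hM h h' =>
    refine IsConnected.union ?_ (IsConnected.union (by rw [inter_comm]; exact h.1) h.isConnected
      hM.isConnected) h'.isConnected
    exact h'.1.mono (inter_subset_inter_left _ subset_union_right)
  | trans h h' ih ih' =>
    refine IsConnected.union (h.right_nonempty.mono (subset_inter ?_ ?_)) ih ih'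
    · exact h.right_subset.trans h.subset
    · exact h'.left_subset.trans h'.subset

theorem Link.isClosed (hA : IsThin A) {N N' S P : Set Y} (h : Link F A N N' S P) :
    IsClosed S ∧ IsClosed P := by
  induction h with
  | bridge hM h h' =>
    exact ⟨(h.isClosed hA).union (h'.isClosed hA),
      ((h.isClosed hA).union hM.isClosed).union (h'.isClosed hA)⟩
  | trans _ _ ih ih' => exact ⟨ih.1.union ih'.1, ih.2.union ih'.2⟩

/-- Every bridge is split. The new bridges hug the old nodes, so away from a neighborhood of `S` the
new chain consists of nodes only and is nowhere dense there. -/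
theorem Link.exists_refinement (hA : IsThin A) {N N' S P : Set Y} (h : Link F A N N' S P)
    {δ : ℝ} (hδ : 0 < δ) : ∃ S' P', Link F A N N' S' P' ∧ P' ⊆ cthickening δ P ∧
      P' ⊆ cthickening δ S ∪ S' := by
  induction h with
  | @bridge N N' M hM h h' =>
    obtain ⟨N₁, M₁, M₂, hl₁, hl₂, h1, h2, h3, h4, hN₁, hM₁, hM₂, hc₁, hc₂⟩ :=
      exists_refined_bridge hA hM h h' hδ
    refine ⟨_, _, (Link.bridge hl₁ h1 h2).trans (Link.bridge hl₂ h3 h4), ?_, ?_⟩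
    · have e1 : N ⊆ cthickening δ (N ∪ M ∪ N') :=
        (subset_union_left.trans subset_union_left).trans (self_subset_cthickening _)
      have e2 : N' ⊆ cthickening δ (N ∪ M ∪ N') :=
        subset_union_right.trans (self_subset_cthickening _)
      have e3 : M ⊆ cthickening δ (N ∪ M ∪ N') :=
        (subset_union_right.trans subset_union_left).trans (self_subset_cthickening _)
      have e4 : N₁ ⊆ cthickening δ (N ∪ M ∪ N') :=
        hN₁.trans (cthickening_subset_of_subset _ (subset_union_right.trans subset_union_left))
      exact union_subset (union_subset (union_subset e1 (hM₁.trans e3)) e4)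
        (union_subset (union_subset e4 (hM₂.trans e3)) e2)
    · have e1 := cthickening_subset_of_subset δ (subset_union_left (s := N) (t := N'))
      have e2 := cthickening_subset_of_subset δ (subset_union_right (s := N) (t := N'))
      have e3 := hc₁.trans e1
      have e4 := hc₂.trans e2
      intro x hx
      rcases hx with ((hx | hx) | hx) | ((hx | hx) | hx)
      · exact Or.inr (Or.inl (Or.inl hx))
      · exact Or.inl (e3 hx)
      · exact Or.inr (Or.inl (Or.inr hx))
      · exact Or.inr (Or.inr (Or.inl hx))
      · exact Or.inl (e4 hx)
      · exact Or.inr (Or.inr (Or.inr hx))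
  | @trans N N' N'' S S' P P' _ _ ih ih' =>
    obtain ⟨S₁, P₁, hl, h1, h2⟩ := ih
    obtain ⟨S₂, P₂, hl', h1', h2'⟩ := ih'
    refine ⟨_, _, hl.trans hl', ?_, ?_⟩
    · exact union_subset (h1.trans (cthickening_subset_of_subset _ subset_union_left))
        (h1'.trans (cthickening_subset_of_subset _ subset_union_right))
    · have e1 := cthickening_subset_of_subset δ (subset_union_left (s := S) (t := S'))
      have e2 := cthickening_subset_of_subset δ (subset_union_right (s := S) (t := S'))
      rintro x (hx | hx)
      · exact (h2 hx).imp (fun h => e1 h) Or.inl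
      · exact (h2' hx).imp (fun h => e2 h) Or.inr

theorem Link.exists_thinner (hA : IsThin A) {N N' S P O : Set Y} (h : Link F A N N' S P)
    (hO : IsOpen O) (hne : O.Nonempty) {ε : ℝ} (hε : 0 < ε) :
    ∃ S' P' ε', Link F A N N' S' P' ∧ 0 < ε' ∧ cthickening ε' P' ⊆ cthickening ε P ∧
      ¬ O ⊆ cthickening ε' P' := by
  have hnot : ∀ {S P O}, Link F A N N' S P → IsOpen O → O.Nonempty → ¬ O ⊆ S := by
    intro S P O h hO ⟨x, hx⟩ hOS
    have := h.isNowhereDense hA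
    rw [(h.isClosed hA).1.isNowhereDense_iff] at this
    exact (this ▸ interior_maximal hOS hO hx : x ∈ (∅ : Set Y))
  obtain ⟨δ, hδ, hδO⟩ := exists_cthickening_not_superset (h.isClosed hA).1 (hnot h hO hne)
  -- The bound `δ` leaves part of `O` outside the thickened old nodes; the bound `ε / 2` reserves
  -- room for thickening the new chain.
  obtain ⟨S', P', hl, h1, h2⟩ := h.exists_refinement hA (lt_min hδ (half_pos hε))
  have hO' := hδO _ (min_le_left δ (ε / 2))
  have hOP : ¬ O ⊆ P' := by
    intro hOP
    refine hnot hl (hO.sdiff (isClosed_cthickening (δ := min δ (ε / 2)) (E := S))) ?_ ?_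
    -- The part of `O` off the thickened `S` is open and nonempty, and would have to lie in the
    -- nowhere dense `S'`.
    · exact sdiff_nonempty.2 hO'
    · exact fun x hx => (h2 (hOP hx.1)).resolve_left hx.2
  obtain ⟨η, hη, hηO⟩ := exists_cthickening_not_superset (hl.isClosed hA).2 hOP
  refine ⟨S', P', min η (ε / 2), hl, lt_min hη (half_pos hε), ?_, hηO _ (min_le_left _ _)⟩
  calc cthickening (min η (ε / 2)) P' ⊆ cthickening (ε / 2) P' := cthickening_mono (min_le_right _ _) _
    _ ⊆ cthickening (ε / 2) (cthickening (ε / 2) P) := cthickening_subset_of_subset _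
        (h1.trans (cthickening_mono (min_le_right _ _) _))
    _ ⊆ cthickening (ε / 2 + ε / 2) P :=
        cthickening_cthickening_subset (half_pos hε).le (half_pos hε).le _
    _ = cthickening ε P := by rw [add_halves]

theorem Link.exists_seq (hA : IsThin A) {N N' S P : Set Y} (h : Link F A N N' S P)
    {O : ℕ → Set Y} (hO : ∀ n, IsOpen (O n)) (hne : ∀ n, (O n).Nonempty) :
    ∃ R T : ℕ → Set Y, (∀ n, ∃ S, Link F A N N' S (R n)) ∧ (∀ n, IsClosed (T n)) ∧
      (∀ n, R n ⊆ T n) ∧ Antitone T ∧ ∀ n, ¬ O n ⊆ T (n + 1) := by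
  choose! fS fP fε hf using fun (n : ℕ) (S P : Set Y) (ε : ℝ)
    (h : Link F A N N' S P ∧ 0 < ε) => h.1.exists_thinner hA (hO n) (hne n) h.2
  -- Each state records nodes, chain and radius. The step from `n` to `n + 1` deals with `O n`,
  -- whence the index `n + 1` in the conclusion.
  let x : ℕ → Set Y × Set Y × ℝ := fun n => Nat.rec (S, P, 1)
    (fun n p => (fS n p.1 p.2.1 p.2.2, fP n p.1 p.2.1 p.2.2, fε n p.1 p.2.1 p.2.2)) n
  have hx : ∀ n, Link F A N N' (x n).1 (x n).2.1 ∧ 0 < (x n).2.2 := by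
    intro n
    induction n with
    | zero => exact ⟨h, one_pos⟩
    | succ n ih => exact ⟨(hf n _ _ _ ih).1, (hf n _ _ _ ih).2.1⟩
  exact ⟨fun n => (x n).2.1, fun n => cthickening (x n).2.2 (x n).2.1, fun n => ⟨_, (hx n).1⟩,
    fun n => isClosed_cthickening, fun n => self_subset_cthickening _,
    antitone_nat_of_succ_le fun n => (hf n _ _ _ (hx n)).2.2.1,
    fun n => (hf n _ _ _ (hx n)).2.2.2⟩

/-- Linked components lie in a common connected subset of `A`. -/
theorem Link.exists_isPreconnected (hA : IsThin A) {N N' S P : Set Y} (h : Link F A N N' S P) :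
    ∃ Q ⊆ A, IsPreconnected Q ∧ N ⊆ Q ∧ N' ⊆ Q := by
  have hNA : (N ∩ A).Nonempty := by
    clear hA
    induction h with
    | bridge _ h _ => exact h.isConnected.nonempty.mono (subset_inter Subset.rfl h.subset)
    | trans _ _ ih _ => exact ih
  obtain ⟨y₀, hy₀⟩ := h.right_nonempty
  have hbne : (countableBasis Y).Nonempty := by
    obtain ⟨O, hO, -⟩ := (isBasis_countableBasis Y).exists_subset_of_mem_open (mem_univ y₀)
      isOpen_univ
    exact ⟨O, hO⟩
  obtain ⟨O, hO⟩ := (countable_countableBasis Y).exists_eq_range hbne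
  have hOmem : ∀ n, O n ∈ countableBasis Y := fun n => hO ▸ mem_range_self n
  obtain ⟨R, T, hR, hTc, hRT, hT, hTO⟩ := h.exists_seq hA
    (fun n => isOpen_of_mem_countableBasis (hOmem n))
    (fun n => nonempty_of_mem_countableBasis (hOmem n))
  choose S' hR using hR
  let G : Ultrafilter ℕ := hyperfilter ℕ
  let Q := ultraLim G R
  have hsub : ∀ Z : Set Y, (∀ n, Z ⊆ R n) → Z ⊆ Q := fun Z hZ z hz =>
    mem_ultraLim_of_tendsto (c := fun _ => z) (Eventually.of_forall fun n => hZ n hz)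
      tendsto_const_nhds
  have hNQ : N ⊆ Q := hsub N fun n => (hR n).left_subset.trans (hR n).subset
  have hNQ' : N' ⊆ Q := hsub N' fun n => (hR n).right_subset.trans (hR n).subset
  -- The ultrafilter is nonprincipal, so the limit sees only the tail of the chains and lies in
  -- every `T n`. Hence no basic open set fits in `Q`.
  have hQT : ∀ n, Q ⊆ T n := fun n => by
    refine ultraLim_subset_of_isClosed (hTc n) ?_
    have hev : ∀ᶠ m in (G : Filter ℕ), n ≤ m := by
      refine Filter.Eventually.filter_mono ?_ (eventually_ge_atTop n)
      rw [← Nat.cofinite_eq_atTop]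
      exact hyperfilter_le_cofinite
    filter_upwards [hev] with m hm using (hRT m).trans (hT hm)
  have hQconn : IsConnected Q := isConnected_ultraLim (Eventually.of_forall fun n =>
    (hR n).isConnected)
  have hQnd : IsNowhereDense Q := by
    rw [IsClosed.isNowhereDense_iff isClosed_ultraLim, ← not_nonempty_iff_eq_empty]
    rintro ⟨y, hy⟩
    obtain ⟨B, hB, -, hBQ⟩ := (isBasis_countableBasis Y).exists_subset_of_mem_open hy
      isOpen_interior
    obtain ⟨n, rfl⟩ : B ∈ range O := hO ▸ hB
    exact hTO n (hBQ.trans (interior_subset.trans (hQT _)))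
  refine ⟨Q, hA.subset Q isClosed_ultraLim.isCompact hQconn hQnd ?_
    (hNA.mono (inter_subset_inter_left _ hNQ)), hQconn.isPreconnected, hNQ, hNQ'⟩
  exact ultraLim_subset_of_isClosed isClosed_closure
    (Eventually.of_forall fun n => (hR n).subset_closure)

/-- The components of a thin set form an upper semicontinuous decomposition. -/
theorem IsThin.eventually_component_subset (hA : IsThin A) {a : Y} (ha : a ∈ A) {U : Set Y}
    (hU : IsOpen U) (haU : connectedComponentIn A a ⊆ U) :
    ∀ᶠ b in 𝓝[A] a, connectedComponentIn A b ⊆ U := by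
  rw [nhdsWithin_eq_map_subtype_coe ha, eventually_map]
  by_contra hcon
  rw [not_eventually] at hcon
  obtain ⟨F, hF, hFU⟩ : ∃ F : Ultrafilter A, ↑F ≤ 𝓝 (⟨a, ha⟩ : A) ∧
      ∀ᶠ b : A in (F : Filter A), ¬ connectedComponentIn A (b : Y) ⊆ U := by
    have hne := (frequently_mem_iff_neBot
      (s := {b : A | ¬ connectedComponentIn A (b : Y) ⊆ U})).1 hcon
    obtain ⟨F, hF⟩ := exists_ultrafilter_iff.2 hne
    exact ⟨F, hF.trans inf_le_left, le_principal_iff.1 (hF.trans inf_le_right)⟩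
  let K : A → Set Y := fun b => connectedComponentIn A b
  have hcl : ∀ b, IsClosed (connectedComponentIn A b) := fun b => by
    simpa using hA.isClosed_component isClosed_univ b
  have hK : ∀ b, IsConnected (K b) ∧ IsCompact (K b) ∧ K b ⊆ A := fun b =>
    ⟨isConnected_connectedComponentIn_iff.2 b.2, (hcl b).isCompact,
      connectedComponentIn_subset _ _⟩
  have hM : IsLimOfContinua F A (ultraLim F K) := ⟨K, hK, rfl⟩
  have haM : a ∈ ultraLim F K := mem_ultraLim_of_tendsto (c := Subtype.val)
    (Eventually.of_forall fun b => mem_connectedComponentIn b.2)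
    ((continuous_subtype_val.tendsto (⟨a, ha⟩ : A)).mono_left hF)
  have hMU : ¬ ultraLim F K ⊆ U := fun hsub => by
    obtain ⟨b, hb, hb'⟩ := ((eventually_subset_of_ultraLim_subset hU hsub).and hFU).exists
    exact hb' hb
  have htouch : ∀ b ∈ A, (ultraLim F K ∩ connectedComponentIn A b).Nonempty →
      Touches A (ultraLim F K) (connectedComponentIn A b) := fun b hb h =>
    ⟨h, univ, isClosed_univ, subset_univ _, b, by simpa using hb, by simp⟩
  have hta := htouch a ha ⟨a, haM, mem_connectedComponentIn ha⟩
  by_cases hint : (interior (ultraLim F K)).Nonempty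
  -- An escaping component meets the interior of the limit, so the limit bridges it to the component
  -- of `a`; the chain argument puts both in one connected subset of `A`.
  · obtain ⟨y, hy⟩ := hint
    obtain ⟨b, ⟨z, hz, hzM⟩, hbU⟩ := ((interior_subset hy _ (isOpen_interior.mem_nhds hy)).and
      hFU).exists
    have htb := htouch b b.2 ⟨z, interior_subset hzM, hz⟩
    obtain ⟨Q, hQA, hQ, haQ, hbQ⟩ := (Link.bridge hM hta htb).exists_isPreconnected hA
    exact hbU (hbQ.trans ((hQ.subset_connectedComponentIn
      (haQ (mem_connectedComponentIn ha)) hQA).trans haU))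
  · rw [not_nonempty_iff_eq_empty, ← hM.isClosed.isNowhereDense_iff] at hint
    exact hMU ((hta.absorb hA hM.subset_closure Subset.rfl hM.isClosed hM.isConnected hint
      hta.1).trans haU)

end Thin

/-! ### Zero-dimensionality of component spaces -/

section SumTheorem

variable {Q : Type*} [TopologicalSpace Q] [T4Space Q] [TotallyDisconnectedSpace Q]

/-- A clopen subset of the compact totally disconnected `Z` separates the traces of `E` and `D`.
Adding its two sides to `E` and `D` keeps them disjoint and closed, and normality supplies the
margins. -/
theorem exists_disjoint_closed_enlargement {Z E D : Set Q} (hZ : IsCompact Z) (hE : IsClosed E)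
    (hD : IsClosed D) (hED : Disjoint E D) :
    ∃ E' D', IsClosed E' ∧ IsClosed D' ∧ Disjoint E' D' ∧ E ⊆ interior E' ∧ D ⊆ interior D' ∧
      Z ⊆ E' ∪ D' := by
  have : CompactSpace Z := isCompact_iff_compactSpace.1 hZ
  obtain ⟨C, hC, hEC, hCD⟩ := exists_clopen_of_closed_subset_open
    (Z := (Subtype.val ⁻¹' E : Set Z)) (U := (Subtype.val ⁻¹' Dᶜ : Set Z))
    (hE.preimage continuous_subtype_val) (hD.isOpen_compl.preimage continuous_subtype_val)
    (preimage_mono hED.subset_compl_right)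
  have h1 : IsClosed (E ∪ Subtype.val '' C) :=
    hE.union (hC.1.isCompact.image continuous_subtype_val).isClosed
  have h2 : IsClosed (D ∪ Subtype.val '' Cᶜ) :=
    hD.union (hC.compl.1.isCompact.image continuous_subtype_val).isClosed
  have h12 : E ∪ Subtype.val '' C ⊆ (D ∪ Subtype.val '' Cᶜ)ᶜ := by
    rintro x (hx | ⟨z, hz, rfl⟩) (hx' | ⟨w, hw, hwx⟩)
    · exact hED.le_bot ⟨hx, hx'⟩
    · subst hwx
      exact hw (hEC hx)
    · exact hCD hz hx'
    · exact hw (Subtype.ext hwx ▸ hz)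
  obtain ⟨u, hu, hEu, huD⟩ := normal_exists_closure_subset h1 h2.isOpen_compl h12
  obtain ⟨v, hv, hDv, hvu⟩ := normal_exists_closure_subset h2 isClosed_closure.isOpen_compl
    (subset_compl_comm.1 huD)
  refine ⟨closure u, closure v, isClosed_closure, isClosed_closure,
    (subset_compl_iff_disjoint_left.1 hvu), ?_, ?_, ?_⟩
  · exact (subset_union_left.trans hEu).trans (interior_maximal subset_closure hu)
  · exact (subset_union_left.trans hDv).trans (interior_maximal subset_closure hv)
  · intro x hx
    by_cases hxC : (⟨x, hx⟩ : Z) ∈ C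
    · exact Or.inl (subset_closure (hEu (Or.inr ⟨_, hxC, rfl⟩)))
    · exact Or.inr (subset_closure (hDv (Or.inr ⟨_, hxC, rfl⟩)))

/-- In a `σ`-compact totally disconnected normal Hausdorff space, disjoint closed sets are
separated by a clopen set. -/
theorem exists_isClopen_separating [SigmaCompactSpace Q] {E D : Set Q} (hE : IsClosed E)
    (hD : IsClosed D) (hED : Disjoint E D) : ∃ C, IsClopen C ∧ E ⊆ C ∧ Disjoint C D := by
  choose! f g h using fun (n : ℕ) (E D : Set Q) (h : IsClosed E ∧ IsClosed D ∧ Disjoint E D) =>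
    exists_disjoint_closed_enlargement (isCompact_compactCovering Q n) h.1 h.2.1 h.2.2
  -- The pair absorbs one compact piece at a time. Each stage lies in the interior of the next, so
  -- both unions are open; they are disjoint and exhaust the space.
  let x : ℕ → Set Q × Set Q := fun n => Nat.rec (E, D) (fun n p => (f n p.1 p.2, g n p.1 p.2)) n
  have hx : ∀ n, IsClosed (x n).1 ∧ IsClosed (x n).2 ∧ Disjoint (x n).1 (x n).2 := by
    intro n
    induction n with
    | zero => exact ⟨hE, hD, hED⟩
    | succ n ih => exact ⟨(h n _ _ ih).1, (h n _ _ ih).2.1, (h n _ _ ih).2.2.1⟩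
  have h1 : ∀ n, (x n).1 ⊆ interior (x (n + 1)).1 := fun n => (h n _ _ (hx n)).2.2.2.1
  have h2 : ∀ n, (x n).2 ⊆ interior (x (n + 1)).2 := fun n => (h n _ _ (hx n)).2.2.2.2.1
  have h3 : ∀ n, compactCovering Q n ⊆ (x (n + 1)).1 ∪ (x (n + 1)).2 :=
    fun n => (h n _ _ (hx n)).2.2.2.2.2
  have m1 : Monotone fun n => (x n).1 :=
    monotone_nat_of_le_succ fun n => (h1 n).trans interior_subset
  have m2 : Monotone fun n => (x n).2 :=
    monotone_nat_of_le_succ fun n => (h2 n).trans interior_subset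
  have hopen : ∀ s : ℕ → Set Q, (∀ n, s n ⊆ interior (s (n + 1))) → IsOpen (⋃ n, s n) := by
    intro s hs
    rw [isOpen_iff_mem_nhds]
    intro y hy
    obtain ⟨n, hn⟩ := mem_iUnion.1 hy
    exact mem_of_superset (isOpen_interior.mem_nhds (hs n hn))
      (interior_subset.trans (subset_iUnion s (n + 1)))
  have hdisj : Disjoint (⋃ n, (x n).1) (⋃ n, (x n).2) := by
    rw [Set.disjoint_left]
    intro y hy hy'
    obtain ⟨n, hn⟩ := mem_iUnion.1 hy
    obtain ⟨m, hm⟩ := mem_iUnion.1 hy'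
    exact (hx (max n m)).2.2.le_bot ⟨m1 (le_max_left n m) hn, m2 (le_max_right n m) hm⟩
  have hcompl : (⋃ n, (x n).1)ᶜ = ⋃ n, (x n).2 := by
    refine Subset.antisymm (fun y hy => ?_) hdisj.subset_compl_left
    obtain ⟨n, hn⟩ := mem_iUnion.1 (iUnion_compactCovering Q ▸ mem_univ y)
    rcases h3 n hn with h' | h'
    · exact absurd (mem_iUnion.2 ⟨n + 1, h'⟩) hy
    · exact mem_iUnion.2 ⟨n + 1, h'⟩
  refine ⟨⋃ n, (x n).1, ⟨⟨?_⟩, hopen _ h1⟩, subset_iUnion (fun n => (x n).1) 0, ?_⟩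
  · rw [hcompl]
    exact hopen _ h2
  · exact hdisj.mono_right (subset_iUnion (fun n => (x n).2) 0)

theorem isZeroDimensional_of_sigmaCompact [SigmaCompactSpace Q] : IsZeroDimensional Q := by
  refine isTopologicalBasis_of_isOpen_of_nhds (fun u hu => hu.2) fun y U hy hU => ?_
  obtain ⟨C, hC, hyC, hCU⟩ := exists_isClopen_separating (isClosed_singleton (x := y))
    hU.isClosed_compl (by simpa using hy)
  exact ⟨C, hC, hyC rfl, disjoint_compl_right_iff_subset.1 hCU⟩

end SumTheorem

section ComponentSpace

variable {Z : Type*} [TopologicalSpace Z]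

/-- Upper semicontinuity says that the union of the components inside `U` is open; this carries
normality and a countable basis to the quotient. -/
theorem isOpen_setOf_fiber_subset
    (husc : ∀ (a : Z) (U : Set Z), IsOpen U → connectedComponent a ⊆ U →
      ∀ᶠ b in 𝓝 a, connectedComponent b ⊆ U) {U : Set Z} (hU : IsOpen U) :
    IsOpen {q : ConnectedComponents Z | ConnectedComponents.mk ⁻¹' {q} ⊆ U} := by
  rw [← ConnectedComponents.isQuotientMap_coe.isOpen_preimage, isOpen_iff_mem_nhds]
  intro a ha
  have ha' : connectedComponent a ⊆ U := by
    rw [← connectedComponents_preimage_singleton]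
    exact ha
  filter_upwards [husc a U hU ha'] with b hb
  rw [← connectedComponents_preimage_singleton] at hb
  exact hb

/-- A `σ`-compact, second countable normal Hausdorff space whose components are compact and form an
upper semicontinuous decomposition has a metrizable and zero-dimensional component space. -/
theorem metrizable_and_zeroDimensional_connectedComponents [T4Space Z]
    [SecondCountableTopology Z] [SigmaCompactSpace Z]
    (hcomp : ∀ a : Z, IsCompact (connectedComponent a))
    (husc : ∀ (a : Z) (U : Set Z), IsOpen U → connectedComponent a ⊆ U →
      ∀ᶠ b in 𝓝 a, connectedComponent b ⊆ U) :
    MetrizableSpace (ConnectedComponents Z) ∧ IsZeroDimensional (ConnectedComponents Z) := by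
  let π : Z → ConnectedComponents Z := ConnectedComponents.mk
  have hπc : Continuous π := ConnectedComponents.continuous_coe
  have hπs : Function.Surjective π := ConnectedComponents.surjective_coe
  have hT1 : T1Space (ConnectedComponents Z) := by
    refine ⟨fun q => ?_⟩
    obtain ⟨a, rfl⟩ := hπs q
    rw [← ConnectedComponents.isQuotientMap_coe.isClosed_preimage,
      connectedComponents_preimage_singleton]
    exact isClosed_connectedComponent
  have hN : NormalSpace (ConnectedComponents Z) := by
    refine ⟨fun s t hs ht hst => ?_⟩
    obtain ⟨u, v, hu, hv, hsu, htv, huv⟩ := normal_separation (hs.preimage hπc)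
      (ht.preimage hπc) (hst.preimage π)
    refine ⟨_, _, isOpen_setOf_fiber_subset husc hu, isOpen_setOf_fiber_subset husc hv,
      fun q hq => ?_, fun q hq => ?_, ?_⟩
    · exact (preimage_mono (singleton_subset_iff.2 hq)).trans hsu
    · exact (preimage_mono (singleton_subset_iff.2 hq)).trans htv
    · rw [Set.disjoint_left]
      intro q hq hq'
      obtain ⟨a, rfl⟩ := hπs q
      exact huv.le_bot ⟨hq (mem_singleton _), hq' (mem_singleton _)⟩
  have hT4 : T4Space (ConnectedComponents Z) := {}
  have hsc : SecondCountableTopology (ConnectedComponents Z) := by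
    let B := countableBasis Z
    -- Finite unions of basic sets suffice because the fibers are compact.
    have hbasis : IsTopologicalBasis ((fun t : Set (Set Z) =>
        {q : ConnectedComponents Z | π ⁻¹' {q} ⊆ ⋃₀ t}) '' {t | t.Finite ∧ t ⊆ B}) := by
      refine isTopologicalBasis_of_isOpen_of_nhds ?_ ?_
      · rintro _ ⟨t, ⟨-, ht⟩, rfl⟩
        exact isOpen_setOf_fiber_subset husc
          (isOpen_sUnion fun s hs => isOpen_of_mem_countableBasis (ht hs))
      · intro q W hq hW
        obtain ⟨a, rfl⟩ := hπs q
        have hWo : IsOpen (π ⁻¹' W) := hW.preimage hπc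
        obtain ⟨S, hSB, hS⟩ := (isBasis_countableBasis Z).open_eq_sUnion hWo
        have hK : IsCompact (π ⁻¹' {π a}) := by
          have := hcomp a
          rwa [← connectedComponents_preimage_singleton] at this
        have hsub : π ⁻¹' {π a} ⊆ ⋃₀ S := hS ▸ preimage_mono (singleton_subset_iff.2 hq)
        obtain ⟨t, htS, htf, ht⟩ := hK.elim_finite_subcover_image
          (b := S) (c := id) (fun s hs => isOpen_of_mem_countableBasis (hSB hs))
          (by simpa [← sUnion_eq_biUnion] using hsub)
        rw [← sUnion_image, image_id] at ht
        refine ⟨_, ⟨t, ⟨htf, htS.trans hSB⟩, rfl⟩, ht, fun q' hq' => ?_⟩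
        obtain ⟨b, rfl⟩ := hπs q'
        have hb : b ∈ π ⁻¹' W := by
          rw [hS]
          exact sUnion_subset_sUnion htS (hq' (mem_singleton _))
        exact hb
    exact hbasis.secondCountableTopology
      ((countable_ofPred_finite_subset (countable_countableBasis Z)).image _)
  have hσ : SigmaCompactSpace (ConnectedComponents Z) := by
    rw [← isSigmaCompact_univ_iff, ← hπs.range_eq]
    exact isSigmaCompact_range hπc
  exact ⟨inferInstance, isZeroDimensional_of_sigmaCompact⟩

end ComponentSpace

/-! ### Embedded thin sets -/

theorem Topology.IsEmbedding.image_connectedComponent {Z Y : Type*} [TopologicalSpace Z]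
    [TopologicalSpace Y] {f : Z → Y} (hf : IsEmbedding f) (z : Z) :
    f '' connectedComponent z = connectedComponentIn (range f) (f z) := by
  refine Subset.antisymm ?_ ?_
  · exact (isPreconnected_connectedComponent.image f hf.continuous.continuousOn
      ).subset_connectedComponentIn ⟨z, mem_connectedComponent, rfl⟩ (image_subset_range _ _)
  · have hsub := connectedComponentIn_subset (range f) (f z)
    have him : f '' (f ⁻¹' connectedComponentIn (range f) (f z)) =
        connectedComponentIn (range f) (f z) := image_preimage_eq_of_subset hsub
    have hpre : IsPreconnected (f ⁻¹' connectedComponentIn (range f) (f z)) := by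
      rw [← hf.isInducing.isPreconnected_image, him]
      exact isPreconnected_connectedComponentIn
    rw [← him]
    exact image_mono (hpre.subset_connectedComponent (mem_connectedComponentIn (mem_range_self z)))

theorem metrizable_and_zeroDimensional_of_isThin {Z Y : Type*} [TopologicalSpace Z]
    [SigmaCompactSpace Z] [MetricSpace Y] [CompactSpace Y] {f : Z → Y} (hf : IsEmbedding f)
    (h : IsThin (range f)) :
    MetrizableSpace (ConnectedComponents Z) ∧ IsZeroDimensional (ConnectedComponents Z) := by
  have : MetrizableSpace Z := hf.metrizableSpace
  have : SecondCountableTopology Z := hf.secondCountableTopology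
  refine metrizable_and_zeroDimensional_connectedComponents (fun a => ?_) fun a U hU ha => ?_
  · rw [hf.isInducing.isCompact_iff, hf.image_connectedComponent]
    simpa using (h.isClosed_component isClosed_univ (f a)).isCompact
  · obtain ⟨V, hV, rfl⟩ := hf.isInducing.isOpen_iff.1 hU
    rw [← image_subset_iff, hf.image_connectedComponent] at ha
    have hev := h.eventually_component_subset (mem_range_self a) hV ha
    rw [← hf.map_nhds_eq, eventually_map] at hev
    filter_upwards [hev] with b hb
    rwa [← image_subset_iff, hf.image_connectedComponent]

/-! ### Indecomposable spaces -/

section Indecomposable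

variable {X : Type*} [TopologicalSpace X]

/-- Adding to a connected set one side of a separation of its complement gives a connected set. -/
theorem isPreconnected_compl_of_separation [PreconnectedSpace X] {C U V : Set X}
    (hC : IsPreconnected C) (hU : IsOpen U) (hV : IsOpen V) (hUV : Disjoint U V)
    (hCU : Cᶜ = U ∪ V) : IsPreconnected Vᶜ := by
  have hCV : C ⊆ Vᶜ := fun x hx hxV => (hCU ▸ Or.inr hxV : x ∈ Cᶜ) hx
  have hcov : ∀ x, x ∈ C ∨ x ∈ U ∨ x ∈ V := fun x => by
    by_cases hx : x ∈ C
    · exact Or.inl hx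
    · exact Or.inr (hCU ▸ hx : x ∈ U ∪ V)
  have key : ∀ s t : Set X, IsClosed s → IsClosed t → Vᶜ ⊆ s ∪ t → Vᶜ ∩ (s ∩ t) = ∅ → C ⊆ s →
      Vᶜ ⊆ s ∨ Vᶜ ⊆ t := by
    intro s t hs ht hst hd hCs
    have hTc : IsClosed (Vᶜ ∩ t) := hV.isClosed_compl.inter ht
    have hTo : IsOpen (Vᶜ ∩ t) := by
      -- Since `C ⊆ s`, the part in `t` misses `C` and lies in `U`. It is therefore clopen in the
      -- whole connected space.
      have : (Vᶜ ∩ t)ᶜ = (Vᶜ ∩ s) ∪ Uᶜ := by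
        ext x
        have h1 : x ∈ Vᶜ → x ∈ s ∪ t := fun h => hst h
        have h2 : x ∉ Vᶜ ∩ (s ∩ t) := by simp [hd]
        have h3 : x ∈ U → x ∉ V := fun h h' => hUV.le_bot ⟨h, h'⟩
        have h4 : x ∈ C → x ∈ s := fun h => hCs h
        have h5 : x ∈ C → x ∉ V := fun h => hCV h
        have h6 := hcov x
        simp only [mem_compl_iff, mem_inter_iff, mem_union] at *
        tauto
      rw [← isClosed_compl_iff, this]
      exact (hV.isClosed_compl.inter hs).union hU.isClosed_compl
    rcases isClopen_iff.1 ⟨hTc, hTo⟩ with h | h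
    · exact Or.inl fun x hx => (hst hx).resolve_right fun hxt =>
        (h ▸ ⟨hx, hxt⟩ : x ∈ (∅ : Set X))
    · exact Or.inr fun x _ => (h ▸ mem_univ x : x ∈ Vᶜ ∩ t).2
  rw [isPreconnected_iff_subset_of_disjoint_closed]
  intro s t hs ht hst hd
  rcases isPreconnected_iff_subset_of_disjoint_closed.1 hC s t hs ht (hCV.trans hst)
    (subset_empty_iff.1 (hd ▸ inter_subset_inter_left _ hCV)) with h | h
  · exact key s t hs ht hst hd h
  · exact (key t s ht hs (by rwa [union_comm]) (by rwa [inter_comm t s]) h).symm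

/-- A separation of `Cᶜ` would give two proper closed connected sets covering `X`, each being `C`
plus one side. So `Cᶜ` is connected, and `C` with `closure Cᶜ` is a forbidden decomposition unless
`Cᶜ` is dense. -/
theorem IsIndecomposableSpace.interior_eq_empty (h : IsIndecomposableSpace X) {C : Set X}
    (hC : IsClosed C) (hCc : IsPreconnected C) (hne : C ≠ univ) : interior C = ∅ := by
  obtain ⟨_, hind⟩ := h
  have hcompl : IsPreconnected Cᶜ := by
    intro u v hu hv huv hnu hnv
    by_contra hcon
    have hd : Disjoint (Cᶜ ∩ u) (Cᶜ ∩ v) := by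
      rw [Set.disjoint_left]
      exact fun x hx hx' => hcon ⟨x, hx.1, hx.2, hx'.2⟩
    have hU : IsOpen (Cᶜ ∩ u) := hC.isOpen_compl.inter hu
    have hV : IsOpen (Cᶜ ∩ v) := hC.isOpen_compl.inter hv
    have heq : Cᶜ = (Cᶜ ∩ u) ∪ (Cᶜ ∩ v) := by
      rw [← inter_union_distrib_left, inter_eq_left.2 huv]
    refine hind ⟨_, _, hV.isClosed_compl, isPreconnected_compl_of_separation hCc hU hV hd heq, ?_,
      hU.isClosed_compl, isPreconnected_compl_of_separation hCc hV hU hd.symm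
        (by rwa [union_comm]), ?_, ?_⟩
    · exact compl_ne_univ.2 hnv
    · exact compl_ne_univ.2 hnu
    · rw [← compl_inter, hd.symm.inter_eq, compl_empty]
  have hcl : closure Cᶜ = univ := by
    by_contra hcl
    refine hind ⟨C, _, hC, hCc, hne, isClosed_closure, hcompl.closure, hcl, ?_⟩
    exact eq_univ_of_subset (union_subset_union_right C subset_closure) (union_compl_self C)
  rw [interior_eq_compl_closure_compl, hcl, compl_univ]

end Indecomposable

/-! ### Meager composants -/

section MeagerComposant

variable {Y : Type*} [TopologicalSpace Y] {X : Set Y}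

/-- The union of `P` with a nowhere dense continuum joining it to the base point is again one of the
continua defining `X`. -/
theorem IsMeagerComposant.subset (hX : IsMeagerComposant X) {P : Set Y} (hP : IsCompact P)
    (hPc : IsConnected P) (hnd : IsNowhereDense P) (hne : (P ∩ X).Nonempty) : P ⊆ X := by
  obtain ⟨x, rfl⟩ := hX
  obtain ⟨y, hyP, K, ⟨hK, hKc, hKn, hxK⟩, hyK⟩ := hne
  exact subset_union_left.trans (subset_sUnion_of_mem ⟨hP.union hK,
    IsConnected.union ⟨y, hyP, hyK⟩ hPc hKc, isNowhereDense_union hnd hKn, Or.inr hxK⟩)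

theorem IsIndecomposableSpace.isNowhereDense_image (hind : IsIndecomposableSpace X) {C : Set X}
    (hC : IsPreconnected C) (hne : closure C ≠ univ) :
    IsNowhereDense (Subtype.val '' C : Set Y) :=
  IsNowhereDense.image_val (hind.interior_eq_empty isClosed_closure hC.closure hne)

theorem closure_image_val_inter_subset {C : Set X} (hC : IsClosed C) :
    closure (Subtype.val '' C : Set Y) ∩ X ⊆ Subtype.val '' C := by
  rintro y ⟨hy, hyX⟩
  refine ⟨⟨y, hyX⟩, ?_, rfl⟩
  rw [← hC.closure_eq, IsInducing.subtypeVal.closure_eq_preimage_closure_image]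
  exact hy

/-- The closure of `C` in `Y` is a nowhere dense continuum meeting `X`, so it stays in `X` and adds
nothing to `C`. -/
theorem IsMeagerComposant.isCompact_of_isPreconnected [CompactSpace Y] [T2Space Y]
    (hX : IsMeagerComposant X) (hind : IsIndecomposableSpace X) {C : Set X} (hC : IsClosed C)
    (hCc : IsPreconnected C) (hne : C ≠ univ) : IsCompact C := by
  rcases C.eq_empty_or_nonempty with rfl | hCne
  · exact isCompact_empty
  have hnd := hind.isNowhereDense_image hCc (by rwa [hC.closure_eq])
  have hconn : IsConnected (Subtype.val '' C : Set Y) :=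
    ⟨hCne.image _, hCc.image _ continuous_subtype_val.continuousOn⟩
  have hsub := hX.subset isClosed_closure.isCompact hconn.closure hnd.closure
    (hconn.nonempty.mono (subset_inter subset_closure (Subtype.coe_image_subset X C)))
  rw [Subtype.isCompact_iff]
  exact (isClosed_of_closure_subset ((subset_inter Subset.rfl hsub).trans
    (closure_image_val_inter_subset hC))).isCompact

/-- A noncompact meager composant is a countable union of proper closed connected
subsets. -/
theorem IsMeagerComposant.exists_countable_cover [CompactSpace Y] [T2Space Y]
    [SecondCountableTopology Y] (hX : IsMeagerComposant X) (hnc : ¬ CompactSpace X) :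
    ∃ 𝒮 : Set (Set X), 𝒮.Countable ∧ (∀ C ∈ 𝒮, IsClosed C ∧ IsPreconnected C ∧ C ≠ univ) ∧
      ⋃₀ 𝒮 = univ := by
  have hXsub := hX
  obtain ⟨x, hx⟩ := hX
  obtain ⟨x₀, hx₀⟩ : ∃ x₀ : X, (x₀ : Y) = x := by
    have : Nonempty X := not_isEmpty_iff.1 fun _ => hnc inferInstance
    obtain ⟨y, hy⟩ := this
    rw [hx] at hy
    obtain ⟨K, hK, -⟩ := hy
    exact ⟨⟨x, hx ▸ ⟨K, hK, hK.2.2.2⟩⟩, rfl⟩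
  refine ⟨(fun U : Set X => connectedComponentIn Uᶜ x₀) '' countableBasis X,
    (countable_countableBasis X).image _, ?_, ?_⟩
  · rintro _ ⟨U, hU, rfl⟩
    have hUo := isOpen_of_mem_countableBasis hU
    refine ⟨?_, isPreconnected_connectedComponentIn, fun h => ?_⟩
    · by_cases hxU : x₀ ∈ Uᶜ
      · exact isClosed_of_closure_subset
          (isPreconnected_connectedComponentIn.closure.subset_connectedComponentIn
            (subset_closure (mem_connectedComponentIn hxU))
            (closure_minimal (connectedComponentIn_subset _ _) hUo.isClosed_compl))
      · simp [connectedComponentIn_eq_empty hxU]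
    · obtain ⟨u, hu⟩ := nonempty_of_mem_countableBasis hU
      have hmem : u ∈ connectedComponentIn Uᶜ x₀ := h.ge (mem_univ u)
      exact connectedComponentIn_subset Uᶜ x₀ hmem hu
  · refine eq_univ_of_forall fun q => ?_
    have hq : (q : Y) ∈ meagerComposant x := hx ▸ q.2
    obtain ⟨K, ⟨hK, hKc, hKn, hxK⟩, hqK⟩ := hq
    have hKX : K ⊆ X := hXsub.subset hK hKc hKn ⟨q, hqK, q.2⟩
    have him : (Subtype.val '' (Subtype.val ⁻¹' K : Set X) : Set Y) = K := by
      rw [Subtype.image_preimage_coe, inter_eq_right.2 hKX]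
    have hK' : IsPreconnected (Subtype.val ⁻¹' K : Set X) := by
      rw [← IsInducing.subtypeVal.isPreconnected_image, him]
      exact hKc.isPreconnected
    have hKcl : IsClosed (Subtype.val ⁻¹' K : Set X) := hK.isClosed.preimage continuous_subtype_val
    -- Noncompactness enters here: `K` cannot be all of `X`, so it misses a basic open set `U` and
    -- lies in the component assigned to `U`.
    have hKne : ((Subtype.val ⁻¹' K : Set X)ᶜ).Nonempty := by
      rw [nonempty_compl]
      intro h
      apply hnc
      rw [← isCompact_univ_iff, ← h, Subtype.isCompact_iff, him]
      exact hK
    obtain ⟨y, hy⟩ := hKne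
    obtain ⟨U, hU, -, hUK⟩ := (isBasis_countableBasis X).exists_subset_of_mem_open hy
      hKcl.isOpen_compl
    refine ⟨_, ⟨U, hU, rfl⟩, hK'.subset_connectedComponentIn ?_ (subset_compl_comm.1 hUK) hqK⟩
    simpa [hx₀] using hxK

theorem IsMeagerComposant.sigmaCompactSpace [CompactSpace Y] [T2Space Y]
    [SecondCountableTopology Y] (hX : IsMeagerComposant X) (hind : IsIndecomposableSpace X) :
    SigmaCompactSpace X := by
  by_cases hc : CompactSpace X
  · infer_instance
  · obtain ⟨𝒮, hcount, h𝒮, hcov⟩ := hX.exists_countable_cover hc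
    exact SigmaCompactSpace.of_countable 𝒮 hcount
      (fun C hC => hX.isCompact_of_isPreconnected hind (h𝒮 C hC).1 (h𝒮 C hC).2.1 (h𝒮 C hC).2.2) hcov

/-- A connected subset of `A` has closure in `X` inside `A ≠ univ`, so indecomposability makes it
nowhere dense. The absorption property of `X` together with closedness of `A` in `X` gives the
second condition. -/
theorem IsMeagerComposant.isThin_image (hX : IsMeagerComposant X)
    (hind : IsIndecomposableSpace X) {A : Set X} (hA : IsClosed A) (hne : A ≠ univ) :
    IsThin (Subtype.val '' A : Set Y) where
  isNowhereDense S hSA hS := by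
    have hSX : S ⊆ X := hSA.trans (Subtype.coe_image_subset X A)
    have him : (Subtype.val '' (Subtype.val ⁻¹' S : Set X) : Set Y) = S := by
      rw [Subtype.image_preimage_coe, inter_eq_right.2 hSX]
    rw [← him]
    refine hind.isNowhereDense_image ?_ fun h => hne ?_
    · rw [← IsInducing.subtypeVal.isPreconnected_image, him]
      exact hS
    · refine eq_univ_of_univ_subset (h ▸ closure_minimal ?_ hA)
      rw [← image_subset_image_iff Subtype.val_injective, him]
      exact hSA
  subset P hP hPc hPn hPA hPne :=
    (subset_inter hPA (hX.subset hP hPc hPn (hPne.mono (inter_subset_inter_right _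
      (Subtype.coe_image_subset X A))))).trans (closure_image_val_inter_subset hA)

end MeagerComposant

/-! ### The three properties of an indecomposable meager composant -/

theorem proposition2p3 {Y : Type*} [TopologicalSpace Y] [CompactSpace Y] [ConnectedSpace Y]
    [MetrizableSpace Y] [Nontrivial Y] (X : Set Y) (hX : IsMeagerComposant X)
    (hind : IsIndecomposableSpace X) :
    (∀ C : Set X, IsClosed C → IsPreconnected C → C ≠ univ → IsCompact C) ∧
    (CompactSpace X ∨ IsMeagre (univ : Set X)) ∧
    (∀ A : Set X, IsClosed A →
      MetrizableSpace (ConnectedComponents A) ∧ IsZeroDimensional (ConnectedComponents A)) := by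
  let _ : MetricSpace Y := metrizableSpaceMetric Y
  refine ⟨fun C hC hCc hne => hX.isCompact_of_isPreconnected hind hC hCc hne, ?_, fun A hA => ?_⟩
  · rw [or_iff_not_imp_left]
    intro hnc
    obtain ⟨𝒮, hcount, h𝒮, hcov⟩ := hX.exists_countable_cover hnc
    rw [isMeagre_iff_countable_union_isNowhereDense]
    refine ⟨𝒮, fun C hC => ?_, hcount, hcov.ge⟩
    rw [(h𝒮 C hC).1.isNowhereDense_iff]
    exact hind.interior_eq_empty (h𝒮 C hC).1 (h𝒮 C hC).2.1 (h𝒮 C hC).2.2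
  · have : ConnectedSpace X := hind.1
    -- The whole space is not covered by thinness, but it is connected, so its component space is a
    -- single point.
    by_cases hne : A = univ
    · subst hne
      have : PreconnectedSpace (univ : Set X) := Subtype.preconnectedSpace isPreconnected_univ
      have : DiscreteTopology (ConnectedComponents (univ : Set X)) := inferInstance
      refine ⟨inferInstance, isTopologicalBasis_of_isOpen_of_nhds (fun u hu => hu.2)
        fun y U hy hU => ⟨U, isClopen_discrete U, hy, Subset.rfl⟩⟩
    · have := hX.sigmaCompactSpace hind
      have : SigmaCompactSpace A := hA.isClosedEmbedding_subtypeVal.sigmaCompactSpace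
      refine metrizable_and_zeroDimensional_of_isThin
        (f := fun a : A => ((a : X) : Y)) (IsEmbedding.subtypeVal.comp IsEmbedding.subtypeVal) ?_
      have hr : range (fun a : A => ((a : X) : Y)) = Subtype.val '' A := by
        ext y
        simp
      rw [hr]
      exact hX.isThin_image hind hA hne
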